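/- Let $n\ge 1$ and $r\ge 0$ be integers, let $F_r=\langle x_1,\dots,x_r\rangle$ be the free group of rank $r$, and for $G=\mathrm{GL}_n(\mathbb C)$ or $\mathrm{SL}_n(\mathbb C)$ let $X_r(G)$ be the $G$-character variety of $F_r$, that is, the spectrum of the ring $\mathbb C[\mathrm{Hom}(F_r,G)]^{G}$ of conjugation-invariant regular functions on $\mathrm{Hom}(F_r,G)\cong G^r$. Write $[\rho]$ for the point of $X_r(G)$ defined by $\rho\in\mathrm{Hom}(F_r,G)$. Let $\mu_n\cong\mathbb Z_n$ be the group of $n$-th roots of unity in $\mathbb C$. Then: 1. There is a morphism of complex varieties $$\Phi: X_r(\mathrm{SL}_n(\mathbb C))\times(\mathbb C^*)^r\longrightarrow X_r(\mathrm{GL}_n(\mathbb C)),\qquad ([\rho],t)\longmapsto[t\rho],$$ where $(t\rho)(x_i)=t_i\,\rho(x_i)$, and the formula $\zeta\cdot([\rho],t)=([\zeta\rho],\zeta^{-1}t)$ defines an action of $\mu_n^r$ on $X_r(\mathrm{SL}_n(\mathbb C))\times(\mathbb C^*)^r$ by automorphisms of complex varieties. 2. This action is free on points, and $\Phi$ is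 the quotient map for it: the comorphism of $\Phi$ identifies the coordinate ring of $X_r(\mathrm{GL}_n(\mathbb C))$ with the ring of $\mu_n^r$-invariants in the coordinate ring of $X_r(\mathrm{SL}_n(\mathbb C))\times(\mathbb C^*)^r$, and $\Phi$ is surjective on complex points with the $\mu_n^r$-orbits as its fibres. 3. $\Phi$ is étale and surjective. In this sense $X_r(\mathrm{GL}_n(\mathbb C))$ and $X_r(\mathrm{SL}_n(\mathbb C))\times(\mathbb C^*)^r$ are étale equivalent. -/

import Mathlib

open scoped TensorProduct

noncomputable section

namespace CharVar

/-- `Hom(F_r, G)`, where `F_r` is the free group on `x_1, …, x_r`. -/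
abbrev Rep (r : ℕ) (G : Type) [Group G] : Type := FreeGroup (Fin r) →* G

section LinearGroup

variable {G : Type} [Group G] {N : ℕ} (ι : G →* GL (Fin N) ℂ) (r : ℕ)

/-- The coordinate ring `ℂ[Hom(F_r, G)]` of the representation variety, for a linear algebraic
group `G` with closed embedding `ι` in `GL_N`: under `Hom(F_r, G) ≅ G^r` the regular functions are
the polynomials in the matrix entries of the `ρ(x_i)` and in the inverses of their determinants. -/
def repRing : Subalgebra ℂ (Rep r G → ℂ) :=
  Algebra.adjoin ℂ
    ({f | ∃ (i : Fin r) (j k : Fin N),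
        f = fun ρ => (ι (ρ (FreeGroup.of i)) : Matrix (Fin N) (Fin N) ℂ) j k} ∪
      {f | ∃ i : Fin r,
        f = fun ρ => ((ι (ρ (FreeGroup.of i)) : Matrix (Fin N) (Fin N) ℂ).det)⁻¹})

variable {r} in
/-- The conjugation action: `conj g ρ` is `x ↦ g * ρ x * g⁻¹`. -/
def conj (g : G) (ρ : Rep r G) : Rep r G := (MulAut.conj g).toMonoidHom.comp ρ

variable (G) in
/-- The functions on `Hom(F_r, G)` that are invariant under conjugation. -/
def conjInvariants : Subalgebra ℂ (Rep r G → ℂ) where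
  carrier := {f | ∀ (g : G) (ρ : Rep r G), f (conj g ρ) = f ρ}
  mul_mem' hf hh g ρ := by simp only [Pi.mul_apply, hf g ρ, hh g ρ]
  add_mem' hf hh g ρ := by simp only [Pi.add_apply, hf g ρ, hh g ρ]
  algebraMap_mem' _ _ _ := rfl

/-- The coordinate ring `ℂ[Hom(F_r, G)]^G` of the character variety of `G`. -/
def charRing : Subalgebra ℂ (Rep r G → ℂ) := repRing ι r ⊓ conjInvariants G r

/-- The point `[ρ]` of the character variety, as a `ℂ`-point: evaluation of invariants at `ρ`. -/
def charPoint {r : ℕ} (ρ : Rep r G) : charRing ι r →ₐ[ℂ] ℂ :=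
  (Pi.evalAlgHom ℂ (fun _ : Rep r G => ℂ) ρ).comp (charRing ι r).val

end LinearGroup

variable (n r : ℕ)

/-- The coordinate ring of `X_r(GL_n)`. -/
abbrev GLRing : Subalgebra ℂ (Rep r (GL (Fin n) ℂ) → ℂ) :=
  charRing (MonoidHom.id (GL (Fin n) ℂ)) r

/-- The coordinate ring of `X_r(SL_n)`. -/
abbrev SLRing : Subalgebra ℂ (Rep r (Matrix.SpecialLinearGroup (Fin n) ℂ) → ℂ) :=
  charRing (Matrix.SpecialLinearGroup.toGL (n := Fin n) (R := ℂ)) r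

/-- The coordinate ring of the torus `(ℂ*)^r`: Laurent polynomial functions. -/
def torusRing : Subalgebra ℂ ((Fin r → ℂˣ) → ℂ) :=
  Algebra.adjoin ℂ
    ({f | ∃ i : Fin r, f = fun t => ((t i : ℂˣ) : ℂ)} ∪
      {f | ∃ i : Fin r, f = fun t => ((t i : ℂˣ) : ℂ)⁻¹})

variable {r} in
/-- The `ℂ`-point of the torus given by a tuple `t`. -/
def torusPoint (t : Fin r → ℂˣ) : torusRing r →ₐ[ℂ] ℂ :=
  (Pi.evalAlgHom ℂ (fun _ : Fin r → ℂˣ => ℂ) t).comp (torusRing r).val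

/-- The coordinate ring of the product variety `X_r(SL_n) × (ℂ*)^r`. -/
abbrev ProdRing : Type := SLRing n r ⊗[ℂ] torusRing r

/-- `X_r(GL_n)`, as a scheme. -/
abbrev XGL : AlgebraicGeometry.Scheme.{0} :=
  AlgebraicGeometry.Spec (CommRingCat.of (GLRing n r))

/-- `X_r(SL_n) × (ℂ*)^r`, as a scheme. -/
abbrev XSLTorus : AlgebraicGeometry.Scheme.{0} :=
  AlgebraicGeometry.Spec (CommRingCat.of (ProdRing n r))

variable {n r}

/-- The point `([ρ], t)` of `X_r(SL_n) × (ℂ*)^r`. -/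
def prodPoint (ρ : Rep r (Matrix.SpecialLinearGroup (Fin n) ℂ)) (t : Fin r → ℂˣ) :
    ProdRing n r →ₐ[ℂ] ℂ :=
  Algebra.TensorProduct.productMap
    (charPoint (Matrix.SpecialLinearGroup.toGL (n := Fin n) (R := ℂ)) ρ) (torusPoint t)

/-- The representation of `F_r` in `GL_n` with `x_i ↦ t_i ρ(x_i)`. -/
def scaleGL (ρ : Rep r (Matrix.SpecialLinearGroup (Fin n) ℂ)) (t : Fin r → ℂˣ) :
    Rep r (GL (Fin n) ℂ) :=
  FreeGroup.lift fun i => t i • Matrix.SpecialLinearGroup.toGL (ρ (FreeGroup.of i))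

/-- Multiplication of a matrix in `SL_n` by an `n`-th root of unity. -/
def smulSL (ζ : rootsOfUnity n ℂ) (A : Matrix.SpecialLinearGroup (Fin n) ℂ) :
    Matrix.SpecialLinearGroup (Fin n) ℂ :=
  ⟨((ζ : ℂˣ) : ℂ) • (A : Matrix (Fin n) (Fin n) ℂ), by
    have h : ((ζ : ℂˣ) : ℂ) ^ n = 1 := by
      have h' := (mem_rootsOfUnity n (ζ : ℂˣ)).1 ζ.2
      rw [← Units.val_pow_eq_pow_val, h', Units.val_one]
    rw [Matrix.det_smul, Fintype.card_fin, h, one_mul]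
    exact A.2⟩

/-- The representation of `F_r` in `SL_n` with `x_i ↦ ζ_i ρ(x_i)`, for `n`-th roots of unity. -/
def scaleSL (ζ : Fin r → rootsOfUnity n ℂ) (ρ : Rep r (Matrix.SpecialLinearGroup (Fin n) ℂ)) :
    Rep r (Matrix.SpecialLinearGroup (Fin n) ℂ) :=
  FreeGroup.lift fun i => smulSL (ζ i) (ρ (FreeGroup.of i))

/-- A commutative group `Z` acts on the affine variety with coordinate ring `B` through `α`; its
`ℂ`-points are the algebra homomorphisms `p : B → ℂ`, and `ζ` sends `p` to `p ∘ α ζ`.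
The morphism with comorphism `φ : A → B` is the quotient by a free action: `Z` acts freely on
points, `φ` identifies `A` with the ring of invariants of `B` (so it is the GIT quotient), and it
is surjective on points with the `Z`-orbits as its fibres. -/
structure IsFreeQuotient {Z A B : Type} [CommGroup Z] [CommRing A] [Algebra ℂ A] [CommRing B]
    [Algebra ℂ B] (α : Z →* (B ≃ₐ[ℂ] B)) (φ : A →ₐ[ℂ] B) : Prop where
  free : ∀ (ζ : Z) (p : B →ₐ[ℂ] ℂ), p.comp (α ζ).toAlgHom = p → ζ = 1
  injective : Function.Injective φ
  mem_range_iff : ∀ b : B, b ∈ φ.range ↔ ∀ ζ : Z, α ζ b = b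
  surjective_points : ∀ q : A →ₐ[ℂ] ℂ, ∃ p : B →ₐ[ℂ] ℂ, p.comp φ = q
  fibre_iff : ∀ p p' : B →ₐ[ℂ] ℂ,
    p.comp φ = p'.comp φ ↔ ∃ ζ : Z, p' = p.comp (α ζ).toAlgHom

end CharVar

end

/-! Every matrix in `GL_n(ℂ)` is a scalar times a matrix of determinant 1, uniquely up to an `n`-th
root of unity, and scalars act trivially by conjugation. Hence `(ρ, t) ↦ t ρ` is onto, and
conjugation by `GL_n` reduces to conjugation by `SL_n` (`conj_smul_toGL`). Let `A` and `B` be the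
coordinate rings of `X_r(GL_n)` and `X_r(SL_n) × (ℂ*)^r`.

Invariants (`mem_range_scaleComorphism_iff`): any element of `B` is a sum of terms `g(t ρ) w(t)`,
because `ρ = t⁻¹ (t ρ)`. Averaging over `μ_n^r` leaves `g(t ρ)` alone and keeps in `w` only
monomials in `t_i^{±n} = det(t ρ(x_i))^{±1}`, so an invariant element is a regular function of `t
ρ`.

Étaleness (`etale_of_rootsOfUnity_action`): the coordinates `t_i` are units of `B` of weight
`ζ_i⁻¹`. Each isotypic component of `B` is therefore `A` times one monomial `∏ t_i^{e_i}` with `0 ≤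
e_i < n`, and `B` is the Kummer algebra `A[X_i]/(X_i^n - d_i)` with `d_i = t_i^n` a unit of `A`. It
is étale since `n` is invertible. The same units give freeness.

Points (`isFreeQuotient_of_invariants`): `B` is integral over the invariants of a finite group,
which acts transitively on the primes over a given prime. -/

namespace CharVar

/-! ### Kummer algebras are étale. -/

section Kummer

open MvPolynomial

/-- The relations `X_i ^ n = d_i`. -/
noncomputable def kummerRel {A : Type} [CommRing A] (n : ℕ) {r : ℕ} (d : Fin r → A) (i : Fin r) :
    MvPolynomial (Fin r) A :=
  X i ^ n - C (d i)

/-- The algebra `A[X_1, …, X_r] / (X_i ^ n - d_i)`. -/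
abbrev KummerAlgebra {A : Type} [CommRing A] (n : ℕ) {r : ℕ} (d : Fin r → A) : Type :=
  MvPolynomial (Fin r) A ⧸ Ideal.span (Set.range (kummerRel n d))

variable {A : Type} [CommRing A] {n r : ℕ} {d : Fin r → A}

theorem kummerAlgebra_root_pow (i : Fin r) :
    (Ideal.Quotient.mk (Ideal.span (Set.range (kummerRel n d))) (X i)) ^ n =
      algebraMap A (KummerAlgebra n d) (d i) := by
  rw [← map_pow]
  exact Ideal.Quotient.eq.2 (Ideal.subset_span ⟨i, rfl⟩)

/-- The Jacobian matrix is diagonal with entries `n X_i^(n-1)`, and `X_i` is a unit because `X_i^n =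
d_i` is. Equal numbers of variables and relations give relative dimension 0. -/
theorem kummerAlgebra_etale (hn : n ≠ 0) (hnu : IsUnit (n : A)) (hd : ∀ i, IsUnit (d i)) :
    Algebra.Etale A (KummerAlgebra n d) := by
  let P := Algebra.PreSubmersivePresentation.naive (R := A) (v := kummerRel n d) id
    Function.injective_id
  have hJ : P.jacobiMatrix =
      Matrix.diagonal fun i => (n : MvPolynomial (Fin r) A) * X i ^ (n - 1) := by
    ext1 i j
    rw [Algebra.PreSubmersivePresentation.jacobiMatrix_naive]
    by_cases h : i = j
    · subst h
      simp [kummerRel, Derivation.leibniz_pow]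
    · simp [kummerRel, Derivation.leibniz_pow, h, pderiv_X_of_ne (Ne.symm h)]
  have hroot (i : Fin r) :
      IsUnit (Ideal.Quotient.mk (Ideal.span (Set.range (kummerRel n d))) (X i)) := by
    rw [← isUnit_pow_iff hn, kummerAlgebra_root_pow]
    exact (hd i).map _
  have hunit : IsUnit P.jacobian := by
    rw [Algebra.PreSubmersivePresentation.jacobian_eq_jacobiMatrix_det, hJ, Matrix.det_diagonal,
      map_prod, IsUnit.prod_iff]
    intro i _
    rw [map_mul, map_pow]
    refine IsUnit.mul ?_ (IsUnit.pow _ (hroot i))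
    rw [map_natCast, ← map_natCast (algebraMap A (KummerAlgebra n d))]
    exact hnu.map _
  have : Algebra.IsStandardSmoothOfRelativeDimension 0 A (KummerAlgebra n d) :=
    Algebra.SubmersivePresentation.isStandardSmoothOfRelativeDimension ⟨P, hunit⟩
      (by simp [Algebra.Presentation.dimension])
  infer_instance

theorem kummerAlgebra_exists_eq_sum (hn : n ≠ 0) (c : KummerAlgebra n d) :
    ∃ a : (Fin r → Fin n) → A, c = ∑ e, algebraMap A _ (a e) *
      ∏ i, (Ideal.Quotient.mk (Ideal.span (Set.range (kummerRel n d))) (X i)) ^ (e i : ℕ) := by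
  classical
  obtain ⟨p, rfl⟩ := Ideal.Quotient.mk_surjective c
  induction p using MvPolynomial.induction_on' with
  | monomial u a =>
    have hu (i : Fin r) : u i % n < n := Nat.mod_lt _ (Nat.pos_of_ne_zero hn)
    -- Division of the exponents by `n`: `X_i^u = d_i^(u / n) X_i^(u % n)`.
    refine ⟨Pi.single (fun i => ⟨u i % n, hu i⟩) (a * ∏ i, d i ^ (u i / n)), ?_⟩
    rw [Finset.sum_eq_single (fun i => ⟨u i % n, hu i⟩) (by
      intro e _ he; rw [Pi.single_eq_of_ne he]; simp) (by simp), Pi.single_eq_same, map_mul,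
      map_prod, mul_assoc, ← Finset.prod_mul_distrib, monomial_eq, map_mul,
      Finsupp.prod_fintype _ _ (by simp), map_prod]
    congr 1
    refine Finset.prod_congr rfl fun i _ => ?_
    rw [map_pow, map_pow, ← kummerAlgebra_root_pow, ← pow_mul, ← pow_add, Nat.div_add_mod]
  | add p q hp hq =>
    obtain ⟨a, ha⟩ := hp
    obtain ⟨b, hb⟩ := hq
    refine ⟨a + b, ?_⟩
    rw [map_add, ha, hb, ← Finset.sum_add_distrib]
    simp [add_mul]

/-- An extension with a basis of monomials in `n`-th roots of units is étale if `n` is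
invertible. -/
theorem etale_of_monomial_basis {B : Type} [CommRing B] [Algebra A B] (hn : n ≠ 0)
    (hnu : IsUnit (n : A)) (hd : ∀ i, IsUnit (d i)) (t : Fin r → B)
    (ht : ∀ i, t i ^ n = algebraMap A B (d i))
    (hspan : ∀ b : B, ∃ a : (Fin r → Fin n) → A,
      b = ∑ e, algebraMap A B (a e) * ∏ i, t i ^ (e i : ℕ))
    (hind : ∀ a : (Fin r → Fin n) → A,
      ∑ e, algebraMap A B (a e) * ∏ i, t i ^ (e i : ℕ) = 0 → a = 0) :
    Algebra.Etale A B := by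
  have := kummerAlgebra_etale (A := A) (d := d) hn hnu hd
  let f : KummerAlgebra n d →ₐ[A] B := Ideal.Quotient.liftₐ _ (aeval t) (by
    intro p hp
    refine (Ideal.span_le (I := RingHom.ker (aeval t : MvPolynomial (Fin r) A →ₐ[A] B))).2 ?_ hp
    rintro _ ⟨i, rfl⟩
    simp [kummerRel, ht])
  have hf (a : (Fin r → Fin n) → A) : f (∑ e, algebraMap A _ (a e) *
      ∏ i, (Ideal.Quotient.mk (Ideal.span (Set.range (kummerRel n d))) (X i)) ^ (e i : ℕ)) =
      ∑ e, algebraMap A B (a e) * ∏ i, t i ^ (e i : ℕ) := by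
    have hX (i : Fin r) :
        f (Ideal.Quotient.mk (Ideal.span (Set.range (kummerRel n d))) (X i)) = t i :=
      (Ideal.Quotient.lift_mk _ _ _).trans (aeval_X t i)
    simp only [map_sum, map_mul, map_prod, map_pow, hX, AlgHom.commutes]
  refine Algebra.Etale.of_equiv (AlgEquiv.ofBijective f ⟨?_, fun b => ?_⟩)
  -- Monomials need only span the Kummer algebra; their independence in `B` gives injectivity.
  · rw [injective_iff_map_eq_zero]
    intro c hc
    obtain ⟨a, rfl⟩ := kummerAlgebra_exists_eq_sum hn c
    rw [hf] at hc
    simp [hind a hc]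
  · obtain ⟨a, rfl⟩ := hspan b
    exact ⟨_, hf a⟩

end Kummer

/-! ### Characters of `μ_n^r` and their orthogonality. -/

section RootCharacters

variable {n r : ℕ}

noncomputable instance [NeZero n] : Fintype (rootsOfUnity n ℂ) := Fintype.ofFinite _

/-- The character `ζ ↦ ∏ ζ_i ^ m_i` of `μ_n ^ r`. -/
noncomputable def rootChar (n : ℕ) {r : ℕ} (m : Fin r → ℤ) : (Fin r → rootsOfUnity n ℂ) →* ℂ where
  toFun ζ := ((∏ i, (ζ i : ℂˣ) ^ m i : ℂˣ) : ℂ)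
  map_one' := by simp
  map_mul' ζ η := by simp [mul_zpow, Finset.prod_mul_distrib]

theorem rootChar_apply (m : Fin r → ℤ) (ζ : Fin r → rootsOfUnity n ℂ) :
    rootChar n m ζ = ∏ i, ((ζ i : ℂˣ) : ℂ) ^ m i := by
  simp [rootChar]

theorem rootChar_ne_zero (m : Fin r → ℤ) (ζ : Fin r → rootsOfUnity n ℂ) :
    rootChar n m ζ ≠ 0 :=
  Units.ne_zero _

theorem rootChar_eq_one_iff [NeZero n] (m : Fin r → ℤ) :
    rootChar n m = 1 ↔ ∀ i, (n : ℤ) ∣ m i := by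
  classical
  constructor
  · intro h i
    obtain ⟨ω, hω⟩ := HasEnoughRootsOfUnity.exists_primitiveRoot ℂ n
    have := DFunLike.congr_fun h (Pi.mulSingle i hω.toRootsOfUnity)
    rw [rootChar_apply, Finset.prod_eq_single i (by
      intro j _ hj; simp [Pi.mulSingle_eq_of_ne hj]) (by simp), Pi.mulSingle_eq_same] at this
    exact (hω.zpow_eq_one_iff_dvd _).1 (by simpa using this)
  · intro h
    refine MonoidHom.ext fun ζ => ?_
    rw [rootChar_apply, MonoidHom.one_apply]
    refine Finset.prod_eq_one fun i _ => ?_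
    obtain ⟨k, hk⟩ := h i
    have h1 : ((ζ i : ℂˣ) : ℂ) ^ n = 1 := by
      have := (mem_rootsOfUnity n (ζ i : ℂˣ)).1 (ζ i).2
      rw [← Units.val_pow_eq_pow_val, this, Units.val_one]
    rw [hk, zpow_mul, zpow_natCast, h1, one_zpow]

theorem sum_rootChar [NeZero n] (m : Fin r → ℤ) (h : ¬ ∀ i, (n : ℤ) ∣ m i) :
    ∑ ζ, rootChar n m ζ = 0 :=
  sum_hom_units_eq_zero _ (mt (rootChar_eq_one_iff m).1 h)

/-- The sum factors into one geometric sum per coordinate, and a coordinate `ζ_i ≠ 1` makes its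
factor vanish. -/
theorem sum_rootChar_exponents [NeZero n] (ζ : Fin r → rootsOfUnity n ℂ) :
    ∑ e : Fin r → Fin n, rootChar n (fun i => (e i : ℕ)) ζ = if ζ = 1 then (n : ℂ) ^ r else 0 := by
  classical
  simp only [rootChar_apply, zpow_natCast]
  rw [← Fintype.prod_sum (fun (i : Fin r) (k : Fin n) => ((ζ i : ℂˣ) : ℂ) ^ (k : ℕ))]
  split_ifs with h
  · rw [h]
    have h0 (i : Fin r) :
        ((((1 : Fin r → rootsOfUnity n ℂ) i : rootsOfUnity n ℂ) : ℂˣ) : ℂ) = 1 := rfl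
    simp_rw [h0, one_pow]
    simp
  · obtain ⟨i, hi⟩ := Function.ne_iff.1 h
    refine Finset.prod_eq_zero (Finset.mem_univ i) ?_
    have h1 : ((ζ i : ℂˣ) : ℂ) ^ n = 1 := by
      have := (mem_rootsOfUnity n (ζ i : ℂˣ)).1 (ζ i).2
      rw [← Units.val_pow_eq_pow_val, this, Units.val_one]
    have h2 : ((ζ i : ℂˣ) : ℂ) ≠ 1 := fun h2 =>
      hi (Subtype.ext (Units.ext h2))
    rw [Fin.sum_univ_eq_sum_range (fun k => ((ζ i : ℂˣ) : ℂ) ^ k) n]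
    have := geom_sum_mul ((ζ i : ℂˣ) : ℂ) n
    rw [h1, sub_self] at this
    exact (mul_eq_zero.1 this).resolve_right (sub_ne_zero.2 h2)

end RootCharacters

/-! ### Isotypic decomposition under `μ_n^r`. -/

section KummerQuotient

variable {n r : ℕ} {A B : Type} [CommRing A] [Algebra ℂ A] [CommRing B] [Algebra ℂ B]
  {α : (Fin r → rootsOfUnity n ℂ) →* (B ≃ₐ[ℂ] B)} {φ : A →ₐ[ℂ] B} {t : Fin r → B}

theorem map_monomial (hα : ∀ ζ i, α ζ (t i) = ((ζ i : ℂˣ) : ℂ)⁻¹ • t i)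
    (ζ : Fin r → rootsOfUnity n ℂ) (e : Fin r → Fin n) :
    α ζ (∏ i, t i ^ (e i : ℕ)) =
      (rootChar n (fun i => (e i : ℕ)) ζ)⁻¹ • ∏ i, t i ^ (e i : ℕ) := by
  rw [map_prod, rootChar_apply, ← Finset.prod_inv_distrib, ← Finset.prod_smul]
  refine Finset.prod_congr rfl fun i _ => ?_
  rw [map_pow, hα, smul_pow, inv_pow, zpow_natCast]

/-- The monomial is a unit of the same weight as `b`, so the quotient of `b` by it is invariant. -/
theorem exists_eq_mul_monomial (ht : ∀ i, IsUnit (t i))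
    (hα : ∀ ζ i, α ζ (t i) = ((ζ i : ℂˣ) : ℂ)⁻¹ • t i)
    (hinv : ∀ b : B, b ∈ φ.range ↔ ∀ ζ, α ζ b = b) (e : Fin r → Fin n) (b : B)
    (hb : ∀ ζ, α ζ b = (rootChar n (fun i => (e i : ℕ)) ζ)⁻¹ • b) :
    ∃ a : A, b = φ a * ∏ i, t i ^ (e i : ℕ) := by
  have hu : IsUnit (∏ i, t i ^ (e i : ℕ)) :=
    IsUnit.prod_iff.2 fun i _ => (ht i).pow _
  obtain ⟨u, hu⟩ := hu
  have : b * (↑u⁻¹ : B) ∈ φ.range := by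
    rw [hinv]
    intro ζ
    have h1 := map_monomial hα ζ e
    have h2 : α ζ (b * (↑u⁻¹ : B)) * α ζ u = α ζ b := by
      rw [← map_mul, mul_assoc, Units.inv_mul, mul_one]
    rw [hu, h1, hb, ← hu, mul_smul_comm] at h2
    rw [Units.eq_mul_inv_iff_mul_eq]
    exact smul_right_injective B (inv_ne_zero (rootChar_ne_zero (n := n) _ ζ)) h2
  obtain ⟨a, ha⟩ := this
  refine ⟨a, ?_⟩
  have ha' : φ a = b * (↑u⁻¹ : B) := ha
  rw [ha', ← hu, mul_assoc, Units.inv_mul, mul_one]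

theorem exists_eq_sum_monomial [NeZero n] (ht : ∀ i, IsUnit (t i))
    (hα : ∀ ζ i, α ζ (t i) = ((ζ i : ℂˣ) : ℂ)⁻¹ • t i)
    (hinv : ∀ b : B, b ∈ φ.range ↔ ∀ ζ, α ζ b = b) (b : B) :
    ∃ a : (Fin r → Fin n) → A, b = ∑ e, φ (a e) * ∏ i, t i ^ (e i : ℕ) := by
  -- The left side is the projection of `b` to the component whose weight is that of the monomial.
  have key (e : Fin r → Fin n) : ∃ a : A,
      ((n : ℂ) ^ r)⁻¹ • ∑ ζ, rootChar n (fun i => (e i : ℕ)) ζ • α ζ b =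
        φ a * ∏ i, t i ^ (e i : ℕ) := by
    refine exists_eq_mul_monomial ht hα hinv e _ fun η => ?_
    rw [map_smul, map_sum, smul_comm]
    congr 1
    rw [Finset.smul_sum]
    refine Fintype.sum_equiv (Equiv.mulLeft η) _ _ fun ζ => ?_
    rw [Equiv.coe_mulLeft, map_mul, map_mul, map_smul, smul_smul, ← mul_assoc,
      inv_mul_cancel₀ (rootChar_ne_zero _ _), one_mul]
    rfl
  choose a ha using key
  refine ⟨a, ?_⟩
  simp_rw [← ha]
  -- Summing the projections over `e` first leaves only the term `ζ = 1`, which is `b`.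
  rw [← Finset.smul_sum, Finset.sum_comm]
  simp_rw [← Finset.sum_smul, sum_rootChar_exponents]
  simp [NeZero.ne n]

theorem eq_zero_of_sum_monomial_eq_zero [NeZero n] (ht : ∀ i, IsUnit (t i))
    (hα : ∀ ζ i, α ζ (t i) = ((ζ i : ℂˣ) : ℂ)⁻¹ • t i) (hφ : Function.Injective φ)
    (hinv : ∀ b : B, b ∈ φ.range ↔ ∀ ζ, α ζ b = b) (a : (Fin r → Fin n) → A)
    (h : ∑ e, φ (a e) * ∏ i, t i ^ (e i : ℕ) = 0) : a = 0 := by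
  funext e₀
  have hfix (x : A) (ζ) : α ζ (φ x) = φ x := (hinv _).1 ⟨x, rfl⟩ ζ
  -- Projecting to the component of `e₀` kills every other `e`, since `|e₀ i - e i| < n` makes the
  -- character of `e₀ - e` nontrivial.
  have h1 : ∑ ζ, rootChar n (fun i => (e₀ i : ℕ)) ζ •
      α ζ (∑ e, φ (a e) * ∏ i, t i ^ (e i : ℕ)) = 0 := by
    simp [h]
  simp_rw [map_sum, map_mul, map_monomial hα, hfix, Finset.smul_sum] at h1
  rw [Finset.sum_comm, Finset.sum_eq_single e₀] at h1
  · simp_rw [mul_smul_comm, smul_smul, mul_inv_cancel₀ (rootChar_ne_zero _ _), one_smul] at h1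
    rw [Finset.sum_const, ← Nat.cast_smul_eq_nsmul ℂ, smul_eq_zero] at h1
    have h2 := h1.resolve_left (by simp)
    have hu : IsUnit (∏ i, t i ^ (e₀ i : ℕ)) := IsUnit.prod_iff.2 fun i _ => (ht i).pow _
    rw [hu.mul_left_eq_zero] at h2
    exact (map_eq_zero_iff φ hφ).1 h2
  · intro e _ he
    have h2 (ζ) : rootChar n (fun i => (e₀ i : ℕ)) ζ •
        (φ (a e) * (rootChar n (fun i => (e i : ℕ)) ζ)⁻¹ • ∏ i, t i ^ (e i : ℕ)) =
        rootChar n (fun i => ((e₀ i : ℕ) : ℤ) - (e i : ℕ)) ζ •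
          (φ (a e) * ∏ i, t i ^ (e i : ℕ)) := by
      rw [mul_smul_comm, smul_smul]
      congr 1
      simp only [rootChar_apply, ← Finset.prod_inv_distrib, ← Finset.prod_mul_distrib]
      refine Finset.prod_congr rfl fun i _ => ?_
      rw [zpow_sub₀ (Units.ne_zero _), div_eq_mul_inv]
    simp_rw [h2]
    rw [← Finset.sum_smul, sum_rootChar, zero_smul]
    intro hdvd
    refine he (funext fun i => Fin.ext ?_)
    have := Int.eq_zero_of_abs_lt_dvd (hdvd i) (by
      have := (e i).2
      have := (e₀ i).2
      rw [abs_lt]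
      constructor <;> omega)
    omega
  · simp

theorem etale_of_rootsOfUnity_action [NeZero n] (ht : ∀ i, IsUnit (t i))
    (hα : ∀ ζ i, α ζ (t i) = ((ζ i : ℂˣ) : ℂ)⁻¹ • t i) (hφ : Function.Injective φ)
    (hinv : ∀ b : B, b ∈ φ.range ↔ ∀ ζ, α ζ b = b) : φ.toRingHom.Etale := by
  have hd (i : Fin r) : ∃ d : A, IsUnit d ∧ φ d = t i ^ n := by
    have hmem (u : B) (hu : ∀ ζ, α ζ u = ((ζ i : ℂˣ) : ℂ)⁻¹ • u) : u ^ n ∈ φ.range := by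
      rw [hinv]
      intro ζ
      have h1 : ((ζ i : ℂˣ) : ℂ) ^ n = 1 := by
        have := (mem_rootsOfUnity n (ζ i : ℂˣ)).1 (ζ i).2
        rw [← Units.val_pow_eq_pow_val, this, Units.val_one]
      rw [map_pow, hu, smul_pow, inv_pow, h1, inv_one, one_smul]
    obtain ⟨d, hd⟩ := hmem (t i) fun ζ => hα ζ i
    have hd : φ d = t i ^ n := hd
    obtain ⟨u, hu⟩ := (ht i).pow n
    -- The inverse of `t_i^n` is invariant too, so `d` is a unit already in `A`.
    have : (↑u⁻¹ : B) ∈ φ.range := by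
      rw [hinv]
      intro ζ
      have h1 : α ζ u = u := by
        rw [hu]
        exact (hinv _).1 ⟨d, hd⟩ ζ
      calc α ζ (↑u⁻¹ : B) = α ζ (↑u⁻¹ : B) * (α ζ u * (↑u⁻¹ : B)) := by
            rw [h1, Units.mul_inv, mul_one]
        _ = (↑u⁻¹ : B) := by rw [← mul_assoc, ← map_mul, Units.inv_mul, map_one, one_mul]
    obtain ⟨c, hc⟩ := this
    have hc : φ c = (↑u⁻¹ : B) := hc
    refine ⟨d, IsUnit.of_mul_eq_one c (hφ ?_), hd⟩
    rw [map_mul, hd, hc, ← hu, Units.mul_inv, map_one]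
  choose d hdu hd using hd
  let : Algebra A B := φ.toRingHom.toAlgebra
  have hnu : IsUnit (n : A) := by
    rw [← map_natCast (algebraMap ℂ A)]
    exact (IsUnit.mk0 _ (NeZero.ne _)).map _
  exact etale_of_monomial_basis (NeZero.ne n) hnu hdu t (fun i => (hd i).symm)
    (exists_eq_sum_monomial ht hα hinv) (eq_zero_of_sum_monomial_eq_zero ht hα hφ hinv)

end KummerQuotient

/-! ### Complex points of a quotient by a finite group. -/

section FiniteQuotient

variable {Z A B : Type} [CommGroup Z] [Finite Z] [CommRing A] [Algebra ℂ A] [CommRing B]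
  [Algebra ℂ B] {α : Z →* (B ≃ₐ[ℂ] B)} {φ : A →ₐ[ℂ] B}

theorem isIntegral_of_invariants (hinv : ∀ b : B, b ∈ φ.range ↔ ∀ ζ, α ζ b = b) :
    φ.toRingHom.IsIntegral := by
  let : Algebra A B := φ.toRingHom.toAlgebra
  let : MulSemiringAction Z B := MulSemiringAction.compHom B α
  have : Algebra.IsInvariant A B Z := ⟨fun b hb => (hinv b).2 hb⟩
  exact algebraMap_isIntegral_iff.2 (Algebra.IsInvariant.isIntegral A B Z)

theorem surjective_specMap_of_invariants (hφ : Function.Injective φ)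
    (hinv : ∀ b : B, b ∈ φ.range ↔ ∀ ζ, α ζ b = b) :
    AlgebraicGeometry.Surjective (AlgebraicGeometry.Spec.map (CommRingCat.ofHom φ.toRingHom)) :=
  ⟨(isIntegral_of_invariants hinv).comap_surjective hφ⟩

/-- The kernel of `p` contains `b - p(b)`. Questions about points thus become questions about prime
ideals. -/
theorem algHom_eq_of_ker_le (p q : B →ₐ[ℂ] ℂ) (h : RingHom.ker p ≤ RingHom.ker q) : p = q := by
  ext b
  have : b - algebraMap ℂ B (p b) ∈ RingHom.ker p := by simp [RingHom.mem_ker]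
  have := h this
  rw [RingHom.mem_ker, map_sub, AlgHom.commutes, sub_eq_zero] at this
  exact this.symm

theorem isFreeQuotient_of_invariants
    (hfree : ∀ (ζ : Z) (p : B →ₐ[ℂ] ℂ), p.comp (α ζ).toAlgHom = p → ζ = 1)
    (hφ : Function.Injective φ) (hinv : ∀ b : B, b ∈ φ.range ↔ ∀ ζ, α ζ b = b) :
    IsFreeQuotient α φ where
  free := hfree
  injective := hφ
  mem_range_iff := hinv
  surjective_points q := by
    let : Algebra A B := φ.toRingHom.toAlgebra
    have : IsScalarTower ℂ A B := IsScalarTower.of_algHom φ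
    have : Algebra.IsIntegral A B := algebraMap_isIntegral_iff.1 (isIntegral_of_invariants hinv)
    have : (RingHom.ker q).IsMaximal := RingHom.ker_isMaximal_of_surjective q fun c =>
      ⟨algebraMap ℂ A c, by simp⟩
    obtain ⟨Q, hQ, hQq⟩ := Ideal.exists_ideal_over_maximal_of_isIntegral (S := B) (RingHom.ker q)
      (((RingHom.injective_iff_ker_eq_bot (algebraMap A B)).1 hφ).trans_le bot_le)
    -- Applying `q` to the coefficients of an integral equation over `A` gives one over `ℂ`; hence
    -- the residue field at `Q` is `ℂ`.
    have hint : Algebra.IsIntegral ℂ (B ⧸ Q) := by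
      refine ⟨fun x => ?_⟩
      obtain ⟨b, rfl⟩ := Ideal.Quotient.mk_surjective x
      obtain ⟨P, hP, hPb⟩ := Algebra.IsIntegral.isIntegral (R := A) b
      refine ⟨P.map q, hP.map _, ?_⟩
      rw [Polynomial.eval₂_map]
      have h1 : (algebraMap ℂ (B ⧸ Q)).comp (q : A →+* ℂ) =
          (Ideal.Quotient.mk Q).comp (algebraMap A B) := by
        ext a
        have : a - algebraMap ℂ A (q a) ∈ RingHom.ker q := by simp [RingHom.mem_ker]
        rw [← hQq, Ideal.mem_comap, map_sub, ← IsScalarTower.algebraMap_apply ℂ A B] at this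
        exact (Ideal.Quotient.eq.2 this).symm
      rw [h1, ← Polynomial.hom_eval₂, hPb, map_zero]
    have hbij : Function.Bijective (algebraMap ℂ (B ⧸ Q)) :=
      IsAlgClosed.algebraMap_bijective_of_isIntegral
    let e : ℂ ≃ₐ[ℂ] (B ⧸ Q) := AlgEquiv.ofBijective (Algebra.ofId ℂ (B ⧸ Q)) hbij
    refine ⟨e.symm.toAlgHom.comp (Ideal.Quotient.mkₐ ℂ Q), (algHom_eq_of_ker_le _ _ ?_).symm⟩
    intro a ha
    have h1 : algebraMap A B a ∈ Q := by rwa [← Ideal.mem_comap, hQq]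
    have h2 : Ideal.Quotient.mkₐ ℂ Q (φ a) = 0 := Ideal.Quotient.eq_zero_iff_mem.2 h1
    rw [RingHom.mem_ker, AlgHom.comp_apply, AlgHom.comp_apply, h2, map_zero]
  fibre_iff p p' := by
    constructor
    · intro h
      let : Algebra A B := φ.toRingHom.toAlgebra
      let : MulSemiringAction Z B := MulSemiringAction.compHom B α
      have : Algebra.IsInvariant A B Z := ⟨fun b hb => (hinv b).2 hb⟩
      have : SMulCommClass Z A B := ⟨fun ζ a b => by
        change α ζ (φ a * b) = φ a * α ζ b
        rw [map_mul, (hinv (φ a)).1 ⟨a, rfl⟩ ζ]⟩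
      have hunder : (RingHom.ker p').under A = (RingHom.ker p).under A := by
        ext a
        change p' (φ a) = 0 ↔ p (φ a) = 0
        rw [← AlgHom.comp_apply, ← AlgHom.comp_apply, h]
      have := RingHom.ker_isPrime p
      have := RingHom.ker_isPrime p'
      -- Transitivity of `Z` on the primes over a given prime of `A`.
      obtain ⟨ζ, hζ⟩ := Algebra.IsInvariant.exists_smul_of_under_eq A B Z
        (RingHom.ker p') (RingHom.ker p) hunder
      refine ⟨ζ, algHom_eq_of_ker_le _ _ fun b hb => ?_⟩
      have h1 : ζ • b ∈ RingHom.ker p := by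
        rw [hζ]
        exact Ideal.smul_mem_pointwise_smul ζ b _ hb
      exact h1
    · rintro ⟨ζ, rfl⟩
      ext a
      change p (φ a) = p (α ζ (φ a))
      rw [(hinv (φ a)).1 ⟨a, rfl⟩ ζ]

end FiniteQuotient

/-! ### Tensor products of function algebras as functions on a product. -/

section FunctionTensor

variable {X Y : Type}

/-- The product `f(x) w(y)` of functions of separate variables, as an algebra homomorphism on the
tensor product. -/
noncomputable def fnEval (X : Type) (W : Subalgebra ℂ (Y → ℂ)) :
    (X → ℂ) ⊗[ℂ] W →ₐ[ℂ] (X × Y → ℂ) :=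
  Algebra.TensorProduct.productMap
    (AlgHom.pi fun p : X × Y => Pi.evalAlgHom ℂ (fun _ : X => ℂ) p.1)
    ((AlgHom.pi fun p : X × Y => Pi.evalAlgHom ℂ (fun _ : Y => ℂ) p.2).comp W.val)

theorem fnEval_tmul (W : Subalgebra ℂ (Y → ℂ)) (f : X → ℂ) (w : W) (p : X × Y) :
    fnEval X W (f ⊗ₜ w) p = f p.1 * (w : Y → ℂ) p.2 := rfl

/-- Evaluation of the second tensor factor at a point. -/
noncomputable def tensorSlice (Q : Type) [AddCommGroup Q] [Module ℂ Q] (W : Subalgebra ℂ (Y → ℂ))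
    (y : Y) : Q ⊗[ℂ] W →ₗ[ℂ] Q :=
  (TensorProduct.rid ℂ Q).toLinearMap.comp
    (LinearMap.lTensor Q ((LinearMap.proj y).comp W.val.toLinearMap))

theorem tensorSlice_tmul {Q : Type} [AddCommGroup Q] [Module ℂ Q] (W : Subalgebra ℂ (Y → ℂ))
    (y : Y) (q : Q) (w : W) : tensorSlice Q W y (q ⊗ₜ w) = (w : Y → ℂ) y • q := by
  simp [tensorSlice]

/-- Along a basis `b_i` of `Q`, `x = ∑ b_i ⊗ c_i` has slices `∑ c_i(y) b_i`, so every `c_i` vanishes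
everywhere. `Q` is arbitrary so that quotients of function spaces are allowed. -/
theorem eq_zero_of_tensorSlice_eq_zero {Q : Type} [AddCommGroup Q] [Module ℂ Q]
    (W : Subalgebra ℂ (Y → ℂ)) (x : Q ⊗[ℂ] W) (hx : ∀ y, tensorSlice Q W y x = 0) : x = 0 := by
  let b := Module.Basis.ofVectorSpace ℂ Q
  obtain ⟨c, rfl⟩ := TensorProduct.eq_repr_basis_left b x
  have hc : c = 0 := by
    ext i y
    have h := hx y
    rw [Finsupp.sum, map_sum] at h
    simp_rw [tensorSlice_tmul] at h
    by_cases hi : i ∈ c.support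
    · exact linearIndependent_iff'.1 b.linearIndependent c.support (fun i => (c i : Y → ℂ) y) h i hi
    · rw [Finsupp.notMem_support_iff.1 hi]
      rfl
  rw [hc, Finsupp.sum_zero_index]

theorem tensorSlice_eq_fnEval (W : Subalgebra ℂ (Y → ℂ)) (y : Y) (z : (X → ℂ) ⊗[ℂ] W) :
    tensorSlice (X → ℂ) W y z = fun x => fnEval X W z (x, y) := by
  induction z with
  | zero => simp; rfl
  | tmul f w =>
    ext x
    rw [tensorSlice_tmul, fnEval_tmul, Pi.smul_apply, smul_eq_mul, mul_comm]
  | add z w hz hw => rw [map_add, hz, hw, map_add]; rfl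

theorem fnEval_injective (W : Subalgebra ℂ (Y → ℂ)) : Function.Injective (fnEval X W) := by
  rw [injective_iff_map_eq_zero]
  intro z hz
  refine eq_zero_of_tensorSlice_eq_zero W z fun y => ?_
  rw [tensorSlice_eq_fnEval, hz]
  rfl

/-- Products `f(x) w(y)` with `f` in a subalgebra `S`. -/
noncomputable def pairEval (S : Subalgebra ℂ (X → ℂ)) (W : Subalgebra ℂ (Y → ℂ)) :
    S ⊗[ℂ] W →ₐ[ℂ] (X × Y → ℂ) :=
  (fnEval X W).comp (Algebra.TensorProduct.map S.val (AlgHom.id ℂ W))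

theorem pairEval_injective (S : Subalgebra ℂ (X → ℂ)) (W : Subalgebra ℂ (Y → ℂ)) :
    Function.Injective (pairEval S W) :=
  (fnEval_injective W).comp (Module.Flat.rTensor_preserves_injective_linearMap (M := W)
    S.val.toLinearMap Subtype.val_injective)

theorem tensorSlice_rTensor {Q Q' : Type} [AddCommGroup Q] [Module ℂ Q] [AddCommGroup Q']
    [Module ℂ Q'] (W : Subalgebra ℂ (Y → ℂ)) (f : Q →ₗ[ℂ] Q') (y : Y) (z : Q ⊗[ℂ] W) :
    tensorSlice Q' W y (LinearMap.rTensor W f z) = f (tensorSlice Q W y z) := by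
  induction z with
  | zero => simp
  | tmul f w => rw [LinearMap.rTensor_tmul, tensorSlice_tmul, tensorSlice_tmul, map_smul]
  | add z w hz hw => rw [map_add, map_add, map_add, map_add, hz, hw]

/-- Modulo `S` all slices of `z` vanish, so `z` dies in the tensor product of the quotient with `W`;
right exactness lifts it to `S ⊗ W`. -/
theorem mem_range_pairEval (S : Subalgebra ℂ (X → ℂ)) (W : Subalgebra ℂ (Y → ℂ))
    (z : (X → ℂ) ⊗[ℂ] W) (hz : ∀ y, (fun x => fnEval X W z (x, y)) ∈ S) :
    fnEval X W z ∈ (pairEval S W).range := by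
  let V : Submodule ℂ (X → ℂ) := Subalgebra.toSubmodule S
  have hex := rTensor_exact (M := V) (N := X → ℂ) (P := (X → ℂ) ⧸ V) W (f := V.subtype)
    (g := V.mkQ) (by
      rw [LinearMap.exact_iff, Submodule.ker_mkQ, Submodule.range_subtype]) V.mkQ_surjective
  have h0 : LinearMap.rTensor W V.mkQ z = 0 := by
    refine eq_zero_of_tensorSlice_eq_zero W _ fun y => ?_
    rw [tensorSlice_rTensor, tensorSlice_eq_fnEval]
    exact (Submodule.Quotient.mk_eq_zero V).2 (hz y)
  obtain ⟨u, hu⟩ := (hex z).1 h0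
  refine ⟨u, ?_⟩
  rw [← hu]
  rfl

end FunctionTensor

/-! ### Scalar times determinant 1. -/

section Matrices

variable {n : ℕ}

theorem coe_smul_GL (s : ℂˣ) (g : GL (Fin n) ℂ) :
    ((s • g : GL (Fin n) ℂ) : Matrix (Fin n) (Fin n) ℂ) =
      (s : ℂ) • (g : Matrix (Fin n) (Fin n) ℂ) := rfl

theorem exists_eq_smul_toGL (hn : n ≠ 0) (g : GL (Fin n) ℂ) :
    ∃ (s : ℂˣ) (a : Matrix.SpecialLinearGroup (Fin n) ℂ),
      g = s • Matrix.SpecialLinearGroup.toGL a := by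
  obtain ⟨c, hc⟩ := IsAlgClosed.exists_pow_nat_eq
    (g : Matrix (Fin n) (Fin n) ℂ).det (Nat.pos_of_ne_zero hn)
  have hdet : (g : Matrix (Fin n) (Fin n) ℂ).det ≠ 0 :=
    ((Matrix.isUnit_iff_isUnit_det _).1 g.isUnit).ne_zero
  have hc0 : c ≠ 0 := by
    rintro rfl
    rw [zero_pow hn] at hc
    exact hdet hc.symm
  refine ⟨Units.mk0 c hc0, ⟨c⁻¹ • (g : Matrix (Fin n) (Fin n) ℂ), ?_⟩, ?_⟩
  · rw [Matrix.det_smul, Fintype.card_fin, ← hc, inv_pow, inv_mul_cancel₀ (pow_ne_zero n hc0)]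
  · refine Units.ext ?_
    rw [coe_smul_GL]
    change _ = c • c⁻¹ • (g : Matrix (Fin n) (Fin n) ℂ)
    rw [smul_smul, mul_inv_cancel₀ hc0, one_smul]

end Matrices

/-! ### Scaling of representations. -/

section Scaling

variable {n r : ℕ}

theorem scaleGL_of (ρ : Rep r (Matrix.SpecialLinearGroup (Fin n) ℂ)) (t : Fin r → ℂˣ)
    (i : Fin r) : scaleGL ρ t (FreeGroup.of i) =
      t i • Matrix.SpecialLinearGroup.toGL (ρ (FreeGroup.of i)) := by
  simp [scaleGL]

theorem coe_scaleGL_of (ρ : Rep r (Matrix.SpecialLinearGroup (Fin n) ℂ)) (t : Fin r → ℂˣ)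
    (i : Fin r) : (scaleGL ρ t (FreeGroup.of i) : Matrix (Fin n) (Fin n) ℂ) =
      (t i : ℂ) • (ρ (FreeGroup.of i) : Matrix (Fin n) (Fin n) ℂ) := by
  rw [scaleGL_of, coe_smul_GL]
  rfl

theorem det_scaleGL_of (ρ : Rep r (Matrix.SpecialLinearGroup (Fin n) ℂ)) (t : Fin r → ℂˣ)
    (i : Fin r) : (scaleGL ρ t (FreeGroup.of i) : Matrix (Fin n) (Fin n) ℂ).det =
      (t i : ℂ) ^ n := by
  rw [coe_scaleGL_of, Matrix.det_smul, Fintype.card_fin, Matrix.SpecialLinearGroup.det_coe,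
    mul_one]

theorem coe_scaleSL_of (ζ : Fin r → rootsOfUnity n ℂ)
    (ρ : Rep r (Matrix.SpecialLinearGroup (Fin n) ℂ)) (i : Fin r) :
    (scaleSL ζ ρ (FreeGroup.of i) : Matrix (Fin n) (Fin n) ℂ) =
      ((ζ i : ℂˣ) : ℂ) • (ρ (FreeGroup.of i) : Matrix (Fin n) (Fin n) ℂ) := by
  rw [scaleSL, FreeGroup.lift_apply_of]
  rfl

theorem rep_ext_SL {ρ σ : Rep r (Matrix.SpecialLinearGroup (Fin n) ℂ)}
    (h : ∀ i, (ρ (FreeGroup.of i) : Matrix (Fin n) (Fin n) ℂ) = σ (FreeGroup.of i)) : ρ = σ :=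
  FreeGroup.ext_hom _ _ fun i => Subtype.ext (h i)

theorem rep_ext_GL {ρ σ : Rep r (GL (Fin n) ℂ)}
    (h : ∀ i, (ρ (FreeGroup.of i) : Matrix (Fin n) (Fin n) ℂ) = σ (FreeGroup.of i)) : ρ = σ :=
  FreeGroup.ext_hom _ _ fun i => Units.ext (h i)

theorem scaleSL_one (ρ : Rep r (Matrix.SpecialLinearGroup (Fin n) ℂ)) : scaleSL 1 ρ = ρ :=
  rep_ext_SL fun i => by
    rw [coe_scaleSL_of]
    exact one_smul ℂ _

theorem scaleSL_scaleSL (ζ η : Fin r → rootsOfUnity n ℂ)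
    (ρ : Rep r (Matrix.SpecialLinearGroup (Fin n) ℂ)) :
    scaleSL η (scaleSL ζ ρ) = scaleSL (ζ * η) ρ :=
  rep_ext_SL fun i => by
    rw [coe_scaleSL_of, coe_scaleSL_of, coe_scaleSL_of, smul_smul, Pi.mul_apply, Subgroup.coe_mul,
      Units.val_mul, mul_comm]

theorem scaleGL_scaleSL (ζ : Fin r → rootsOfUnity n ℂ)
    (ρ : Rep r (Matrix.SpecialLinearGroup (Fin n) ℂ)) (t : Fin r → ℂˣ) :
    scaleGL (scaleSL ζ ρ) (fun i => (ζ i : ℂˣ)⁻¹ * t i) = scaleGL ρ t :=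
  rep_ext_GL fun i => by
    rw [coe_scaleGL_of, coe_scaleSL_of, coe_scaleGL_of, smul_smul, Units.val_mul,
      mul_right_comm, Units.inv_mul, one_mul]

theorem exists_eq_scaleGL (hn : n ≠ 0) (σ : Rep r (GL (Fin n) ℂ)) :
    ∃ (ρ : Rep r (Matrix.SpecialLinearGroup (Fin n) ℂ)) (t : Fin r → ℂˣ), σ = scaleGL ρ t := by
  choose t a h using fun i => exists_eq_smul_toGL hn (σ (FreeGroup.of i))
  refine ⟨FreeGroup.lift a, t, FreeGroup.ext_hom _ _ fun i => ?_⟩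
  rw [scaleGL_of, h, FreeGroup.lift_apply_of]

/-- Scalars are central, so `s` cancels and `t` passes through the conjugation. -/
theorem conj_smul_toGL (s : ℂˣ) (a : Matrix.SpecialLinearGroup (Fin n) ℂ)
    (ρ : Rep r (Matrix.SpecialLinearGroup (Fin n) ℂ)) (t : Fin r → ℂˣ) :
    conj (s • Matrix.SpecialLinearGroup.toGL a) (scaleGL ρ t) = scaleGL (conj a ρ) t := by
  refine FreeGroup.ext_hom _ _ fun i => ?_
  change (s • Matrix.SpecialLinearGroup.toGL a) * scaleGL ρ t (FreeGroup.of i) *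
    (s • Matrix.SpecialLinearGroup.toGL a)⁻¹ = _
  rw [mul_inv_eq_iff_eq_mul]
  refine Units.ext ?_
  rw [Units.val_mul, Units.val_mul, coe_scaleGL_of, coe_scaleGL_of, coe_smul_GL]
  change (s : ℂ) • (a : Matrix (Fin n) (Fin n) ℂ) * _ = (t i : ℂ) •
    ((a * ρ (FreeGroup.of i) * a⁻¹ : Matrix.SpecialLinearGroup (Fin n) ℂ) :
      Matrix (Fin n) (Fin n) ℂ) * ((s : ℂ) • (a : Matrix (Fin n) (Fin n) ℂ))
  rw [smul_mul_smul_comm, smul_mul_smul_comm, ← Matrix.SpecialLinearGroup.coe_mul,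
    ← Matrix.SpecialLinearGroup.coe_mul, inv_mul_cancel_right, mul_comm (s : ℂ)]

end Scaling

/-! ### Regular functions on representations and on the torus. -/

section RepresentationRing

variable {n r : ℕ}

/-- The regular functions on `Hom(F_r, GL_n)`. -/
abbrev GLRepRing (n r : ℕ) : Subalgebra ℂ (Rep r (GL (Fin n) ℂ) → ℂ) :=
  repRing (MonoidHom.id (GL (Fin n) ℂ)) r

/-- The regular functions on `Hom(F_r, SL_n)`. -/
abbrev SLRepRing (n r : ℕ) : Subalgebra ℂ (Rep r (Matrix.SpecialLinearGroup (Fin n) ℂ) → ℂ) :=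
  repRing (Matrix.SpecialLinearGroup.toGL (n := Fin n) (R := ℂ)) r

theorem entry_mem_GLRepRing (i : Fin r) (j k : Fin n) :
    (fun σ : Rep r (GL (Fin n) ℂ) =>
      (σ (FreeGroup.of i) : Matrix (Fin n) (Fin n) ℂ) j k) ∈ GLRepRing n r :=
  Algebra.subset_adjoin (Or.inl ⟨i, j, k, rfl⟩)

theorem inv_det_mem_GLRepRing (i : Fin r) :
    (fun σ : Rep r (GL (Fin n) ℂ) =>
      ((σ (FreeGroup.of i) : Matrix (Fin n) (Fin n) ℂ).det)⁻¹) ∈ GLRepRing n r :=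
  Algebra.subset_adjoin (Or.inr ⟨i, rfl⟩)

theorem det_mem_GLRepRing (i : Fin r) :
    (fun σ : Rep r (GL (Fin n) ℂ) =>
      (σ (FreeGroup.of i) : Matrix (Fin n) (Fin n) ℂ).det) ∈ GLRepRing n r := by
  have h : (fun σ : Rep r (GL (Fin n) ℂ) =>
      (σ (FreeGroup.of i) : Matrix (Fin n) (Fin n) ℂ).det) =
      ∑ τ : Equiv.Perm (Fin n), ((Equiv.Perm.sign τ : ℤ) : ℂ) • ∏ j,
        fun σ : Rep r (GL (Fin n) ℂ) =>
          (σ (FreeGroup.of i) : Matrix (Fin n) (Fin n) ℂ) (τ j) j := by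
    ext σ
    simp [Matrix.det_apply', Finset.sum_apply, Finset.prod_apply]
  rw [h]
  exact sum_mem fun τ _ => Subalgebra.smul_mem _
    (prod_mem fun j _ => entry_mem_GLRepRing i (τ j) j) _

theorem zpow_det_mem_GLRepRing (i : Fin r) (k : ℤ) :
    (fun σ : Rep r (GL (Fin n) ℂ) =>
      (σ (FreeGroup.of i) : Matrix (Fin n) (Fin n) ℂ).det ^ k) ∈ GLRepRing n r := by
  obtain ⟨m, rfl | rfl⟩ := k.eq_nat_or_neg
  · simp_rw [zpow_natCast]
    exact pow_mem (det_mem_GLRepRing i) m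
  · simp_rw [zpow_neg, zpow_natCast, ← inv_pow]
    exact pow_mem (inv_det_mem_GLRepRing i) m

theorem entry_mem_SLRepRing (i : Fin r) (j k : Fin n) :
    (fun ρ : Rep r (Matrix.SpecialLinearGroup (Fin n) ℂ) =>
      (ρ (FreeGroup.of i) : Matrix (Fin n) (Fin n) ℂ) j k) ∈ SLRepRing n r :=
  Algebra.subset_adjoin (Or.inl ⟨i, j, k, rfl⟩)

theorem SLRepRing_induction (S : Subalgebra ℂ (Rep r (Matrix.SpecialLinearGroup (Fin n) ℂ) → ℂ))
    (h : ∀ i j k, (fun ρ : Rep r (Matrix.SpecialLinearGroup (Fin n) ℂ) =>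
      (ρ (FreeGroup.of i) : Matrix (Fin n) (Fin n) ℂ) j k) ∈ S) : SLRepRing n r ≤ S := by
  refine Algebra.adjoin_le ?_
  rintro f (⟨i, j, k, rfl⟩ | ⟨i, rfl⟩)
  · exact h i j k
  -- Determinants are 1 on `SL_n`, so these generators are constant.
  · have h1 : (fun ρ : Rep r (Matrix.SpecialLinearGroup (Fin n) ℂ) =>
        ((Matrix.SpecialLinearGroup.toGL (ρ (FreeGroup.of i)) :
          Matrix (Fin n) (Fin n) ℂ).det)⁻¹) = 1 := by
      ext ρ
      change (ρ (FreeGroup.of i) : Matrix (Fin n) (Fin n) ℂ).det⁻¹ = 1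
      rw [Matrix.SpecialLinearGroup.det_coe, inv_one]
    rw [h1]
    exact one_mem S

theorem coord_mem_torusRing (i : Fin r) :
    (fun t : Fin r → ℂˣ => ((t i : ℂˣ) : ℂ)) ∈ torusRing r :=
  Algebra.subset_adjoin (Or.inl ⟨i, rfl⟩)

theorem inv_coord_mem_torusRing (i : Fin r) :
    (fun t : Fin r → ℂˣ => ((t i : ℂˣ) : ℂ)⁻¹) ∈ torusRing r :=
  Algebra.subset_adjoin (Or.inr ⟨i, rfl⟩)

/-- The Laurent monomials `t ^ d`. -/
noncomputable def torusMonomial (r : ℕ) :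
    Multiplicative (Fin r → ℤ) →* ((Fin r → ℂˣ) → ℂ) where
  toFun d t := ∏ i, (t i : ℂ) ^ Multiplicative.toAdd d i
  map_one' := by ext t; simp
  map_mul' d e := by
    ext t
    simp only [toAdd_mul, Pi.add_apply, Pi.mul_apply, ← Finset.prod_mul_distrib]
    exact Finset.prod_congr rfl fun i _ => zpow_add₀ (Units.ne_zero _) _ _

theorem torusMonomial_apply (d : Multiplicative (Fin r → ℤ)) (t : Fin r → ℂˣ) :
    torusMonomial r d t = ∏ i, (t i : ℂ) ^ Multiplicative.toAdd d i := rfl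

/-- The generators are Laurent monomials, and these are closed under products. -/
theorem torusRing_le_span_monomials :
    Subalgebra.toSubmodule (torusRing r) ≤ Submodule.span ℂ (Set.range (torusMonomial r)) := by
  rw [torusRing, Algebra.adjoin_eq_span]
  refine Submodule.span_mono ?_
  rw [← MonoidHom.coe_mrange, SetLike.coe_subset_coe, Submonoid.closure_le]
  rintro f (⟨i, rfl⟩ | ⟨i, rfl⟩)
  · refine ⟨Multiplicative.ofAdd (Pi.single i 1), ?_⟩
    ext t
    change ∏ j, (t j : ℂ) ^ (Pi.single i 1 : Fin r → ℤ) j = _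
    rw [Finset.prod_eq_single i (fun j _ hj => by rw [Pi.single_eq_of_ne hj, zpow_zero]) (by simp),
      Pi.single_eq_same, zpow_one]
  · refine ⟨Multiplicative.ofAdd (Pi.single i (-1)), ?_⟩
    ext t
    change ∏ j, (t j : ℂ) ^ (Pi.single i (-1) : Fin r → ℤ) j = _
    rw [Finset.prod_eq_single i (fun j _ hj => by rw [Pi.single_eq_of_ne hj, zpow_zero]) (by simp),
      Pi.single_eq_same, zpow_neg_one]

theorem conj_coe (g : Matrix.SpecialLinearGroup (Fin n) ℂ)
    (ρ : Rep r (Matrix.SpecialLinearGroup (Fin n) ℂ)) (i : Fin r) :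
    (conj g ρ (FreeGroup.of i) : Matrix (Fin n) (Fin n) ℂ) =
      (g : Matrix (Fin n) (Fin n) ℂ) * ρ (FreeGroup.of i) *
        ((g⁻¹ : Matrix.SpecialLinearGroup (Fin n) ℂ) : Matrix (Fin n) (Fin n) ℂ) := by
  change ((g * ρ (FreeGroup.of i) * g⁻¹ : Matrix.SpecialLinearGroup (Fin n) ℂ) :
    Matrix (Fin n) (Fin n) ℂ) = _
  rw [Matrix.SpecialLinearGroup.coe_mul, Matrix.SpecialLinearGroup.coe_mul]

theorem scaleSL_conj (ζ : Fin r → rootsOfUnity n ℂ) (g : Matrix.SpecialLinearGroup (Fin n) ℂ)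
    (ρ : Rep r (Matrix.SpecialLinearGroup (Fin n) ℂ)) :
    scaleSL ζ (conj g ρ) = conj g (scaleSL ζ ρ) :=
  rep_ext_SL fun i => by
    rw [coe_scaleSL_of, conj_coe, conj_coe, coe_scaleSL_of, mul_smul_comm, smul_mul_assoc]

theorem scaleGL_conj (g : Matrix.SpecialLinearGroup (Fin n) ℂ)
    (ρ : Rep r (Matrix.SpecialLinearGroup (Fin n) ℂ)) (t : Fin r → ℂˣ) :
    scaleGL (conj g ρ) t = conj (Matrix.SpecialLinearGroup.toGL g) (scaleGL ρ t) := by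
  rw [← conj_smul_toGL 1 g, one_smul]

end RepresentationRing

/-! ### The comorphism of `([ρ], t) ↦ [t ρ]`. -/

section ProductVariety

variable {n r : ℕ}

/-- The elements of the coordinate ring of `X_r(SL_n) × (ℂ*)^r` as functions of `(ρ, t)`. -/
noncomputable def prodEval (n r : ℕ) : ProdRing n r →ₐ[ℂ]
    (Rep r (Matrix.SpecialLinearGroup (Fin n) ℂ) × (Fin r → ℂˣ) → ℂ) :=
  pairEval (SLRing n r) (torusRing r)

theorem prodEval_injective : Function.Injective (prodEval n r) :=
  pairEval_injective _ _

theorem prodPoint_apply (ρ : Rep r (Matrix.SpecialLinearGroup (Fin n) ℂ)) (t : Fin r → ℂˣ)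
    (b : ProdRing n r) : prodPoint ρ t b = prodEval n r b (ρ, t) := by
  have h : prodPoint ρ t = (Pi.evalAlgHom ℂ (fun _ => ℂ) (ρ, t)).comp (prodEval n r) :=
    Algebra.TensorProduct.ext' fun f w => by
      rw [prodPoint, Algebra.TensorProduct.productMap_apply_tmul]
      rfl
  rw [h]
  rfl

theorem prodRing_ext {b c : ProdRing n r}
    (h : ∀ (ρ : Rep r (Matrix.SpecialLinearGroup (Fin n) ℂ)) (t : Fin r → ℂˣ),
      prodPoint ρ t b = prodPoint ρ t c) : b = c :=
  prodEval_injective <| funext fun p => by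
    rw [← prodPoint_apply, ← prodPoint_apply, h]

/-- Pull-back of functions along `(ρ, t) ↦ t ρ`. -/
noncomputable def scalePullback (n r : ℕ) : (Rep r (GL (Fin n) ℂ) → ℂ) →ₐ[ℂ]
    (Rep r (Matrix.SpecialLinearGroup (Fin n) ℂ) × (Fin r → ℂˣ) → ℂ) :=
  AlgHom.pi fun p => Pi.evalAlgHom ℂ (fun _ => ℂ) (scaleGL p.1 p.2)

theorem scalePullback_mem_range_fnEval {f : Rep r (GL (Fin n) ℂ) → ℂ} (hf : f ∈ GLRepRing n r) :
    scalePullback n r f ∈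
      (fnEval (Rep r (Matrix.SpecialLinearGroup (Fin n) ℂ)) (torusRing r)).range := by
  suffices h : GLRepRing n r ≤ (fnEval (Rep r (Matrix.SpecialLinearGroup (Fin n) ℂ))
      (torusRing r)).range.comap (scalePullback n r) from h hf
  refine Algebra.adjoin_le ?_
  rintro f (⟨i, j, k, rfl⟩ | ⟨i, rfl⟩)
  · refine ⟨(fun ρ => (ρ (FreeGroup.of i) : Matrix (Fin n) (Fin n) ℂ) j k) ⊗ₜ
      ⟨_, coord_mem_torusRing i⟩, ?_⟩
    ext ⟨ρ, t⟩
    change _ * (t i : ℂ) = (scaleGL ρ t (FreeGroup.of i) : Matrix (Fin n) (Fin n) ℂ) j k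
    rw [coe_scaleGL_of, mul_comm]
    rfl
  · refine ⟨1 ⊗ₜ ((⟨_, inv_coord_mem_torusRing i⟩ : torusRing r) ^ n), ?_⟩
    ext ⟨ρ, t⟩
    change 1 * ((t i : ℂ)⁻¹) ^ n =
      ((scaleGL ρ t (FreeGroup.of i) : Matrix (Fin n) (Fin n) ℂ).det)⁻¹
    rw [det_scaleGL_of, one_mul, inv_pow]

theorem slice_mem_SLRepRing {f : Rep r (GL (Fin n) ℂ) → ℂ} (hf : f ∈ GLRepRing n r)
    (t : Fin r → ℂˣ) : (fun ρ => f (scaleGL ρ t)) ∈ SLRepRing n r := by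
  let P : (Rep r (GL (Fin n) ℂ) → ℂ) →ₐ[ℂ]
      (Rep r (Matrix.SpecialLinearGroup (Fin n) ℂ) → ℂ) :=
    AlgHom.pi fun ρ => Pi.evalAlgHom ℂ (fun _ => ℂ) (scaleGL ρ t)
  suffices h : GLRepRing n r ≤ (SLRepRing n r).comap P from h hf
  refine Algebra.adjoin_le ?_
  rintro f (⟨i, j, k, rfl⟩ | ⟨i, rfl⟩)
  · have h1 : P (fun σ => (σ (FreeGroup.of i) : Matrix (Fin n) (Fin n) ℂ) j k) =
        (t i : ℂ) • fun ρ => (ρ (FreeGroup.of i) : Matrix (Fin n) (Fin n) ℂ) j k := by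
      ext ρ
      change (scaleGL ρ t (FreeGroup.of i) : Matrix (Fin n) (Fin n) ℂ) j k = _
      rw [coe_scaleGL_of]
      rfl
    change P (fun σ => (σ (FreeGroup.of i) : Matrix (Fin n) (Fin n) ℂ) j k) ∈ SLRepRing n r
    rw [h1]
    exact Subalgebra.smul_mem _ (entry_mem_SLRepRing i j k) _
  · have h1 : P (fun σ => ((σ (FreeGroup.of i) : Matrix (Fin n) (Fin n) ℂ).det)⁻¹) =
        algebraMap ℂ _ ((t i : ℂ) ^ n)⁻¹ := by
      ext ρ
      change ((scaleGL ρ t (FreeGroup.of i) : Matrix (Fin n) (Fin n) ℂ).det)⁻¹ = _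
      rw [det_scaleGL_of]
      rfl
    change P (fun σ => ((σ (FreeGroup.of i) : Matrix (Fin n) (Fin n) ℂ).det)⁻¹) ∈ SLRepRing n r
    rw [h1]
    exact Subalgebra.algebraMap_mem _ _

/-- `scalePullback_mem_range_fnEval` controls only the dependence on `t`; regularity and invariance
in `ρ` are checked on slices with `t` fixed. -/
theorem scalePullback_mem_range (f : GLRing n r) :
    scalePullback n r f ∈ (prodEval n r).range := by
  obtain ⟨z, hz⟩ := scalePullback_mem_range_fnEval f.2.1
  have hz : fnEval _ (torusRing r) z = scalePullback n r f := hz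
  rw [← hz]
  refine mem_range_pairEval (SLRing n r) (torusRing r) z fun t => ?_
  rw [hz]
  refine ⟨slice_mem_SLRepRing f.2.1 t, fun g ρ => ?_⟩
  change (f : _ → ℂ) (scaleGL (conj g ρ) t) = (f : _ → ℂ) (scaleGL ρ t)
  rw [scaleGL_conj]
  exact f.2.2 _ _

/-- The comorphism of `([ρ], t) ↦ [t ρ]`. -/
noncomputable def scaleComorphism (n r : ℕ) : GLRing n r →ₐ[ℂ] ProdRing n r :=
  (AlgEquiv.ofInjective (prodEval n r) prodEval_injective).symm.toAlgHom.comp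
    (((scalePullback n r).comp (GLRing n r).val).codRestrict _ scalePullback_mem_range)

theorem prodEval_scaleComorphism (f : GLRing n r) :
    prodEval n r (scaleComorphism n r f) = scalePullback n r f :=
  congrArg Subtype.val ((AlgEquiv.ofInjective (prodEval n r) prodEval_injective).apply_symm_apply
    ⟨scalePullback n r f, scalePullback_mem_range f⟩)

theorem prodPoint_scaleComorphism (ρ : Rep r (Matrix.SpecialLinearGroup (Fin n) ℂ))
    (t : Fin r → ℂˣ) (f : GLRing n r) :
    prodPoint ρ t (scaleComorphism n r f) = (f : Rep r (GL (Fin n) ℂ) → ℂ) (scaleGL ρ t) := by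
  rw [prodPoint_apply, prodEval_scaleComorphism]
  rfl

theorem scaleComorphism_injective (hn : n ≠ 0) : Function.Injective (scaleComorphism n r) := by
  intro f g h
  ext σ
  obtain ⟨ρ, t, rfl⟩ := exists_eq_scaleGL hn σ
  rw [← prodPoint_scaleComorphism, ← prodPoint_scaleComorphism, h]

end ProductVariety

/-! ### The action of `μ_n^r`. -/

section Action

variable {n r : ℕ}

theorem comp_scaleSL_mem (ζ : Fin r → rootsOfUnity n ℂ) (f : SLRing n r) :
    (fun ρ => (f : Rep r (Matrix.SpecialLinearGroup (Fin n) ℂ) → ℂ) (scaleSL ζ ρ)) ∈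
      SLRing n r := by
  refine ⟨?_, fun g ρ => ?_⟩
  · let P : (Rep r (Matrix.SpecialLinearGroup (Fin n) ℂ) → ℂ) →ₐ[ℂ]
        (Rep r (Matrix.SpecialLinearGroup (Fin n) ℂ) → ℂ) :=
      AlgHom.pi fun ρ => Pi.evalAlgHom ℂ (fun _ => ℂ) (scaleSL ζ ρ)
    suffices h : SLRepRing n r ≤ (SLRepRing n r).comap P from h f.2.1
    refine SLRepRing_induction _ fun i j k => ?_
    have h1 : P (fun ρ => (ρ (FreeGroup.of i) : Matrix (Fin n) (Fin n) ℂ) j k) =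
        ((ζ i : ℂˣ) : ℂ) • fun ρ => (ρ (FreeGroup.of i) : Matrix (Fin n) (Fin n) ℂ) j k := by
      ext ρ
      change (scaleSL ζ ρ (FreeGroup.of i) : Matrix (Fin n) (Fin n) ℂ) j k = _
      rw [coe_scaleSL_of]
      rfl
    rw [Subalgebra.mem_comap, h1]
    exact Subalgebra.smul_mem _ (entry_mem_SLRepRing i j k) _
  · change (f : _ → ℂ) (scaleSL ζ (conj g ρ)) = (f : _ → ℂ) (scaleSL ζ ρ)
    rw [scaleSL_conj]
    exact f.2.2 _ _

theorem comp_mul_mem_torusRing (s : Fin r → ℂˣ) (w : torusRing r) :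
    (fun t => (w : (Fin r → ℂˣ) → ℂ) (fun i => s i * t i)) ∈ torusRing r := by
  let P : ((Fin r → ℂˣ) → ℂ) →ₐ[ℂ] ((Fin r → ℂˣ) → ℂ) :=
    AlgHom.pi fun t => Pi.evalAlgHom ℂ (fun _ => ℂ) (fun i => s i * t i)
  suffices h : torusRing r ≤ (torusRing r).comap P from h w.2
  refine Algebra.adjoin_le ?_
  rintro f (⟨i, rfl⟩ | ⟨i, rfl⟩)
  · have h1 : P (fun t => (t i : ℂ)) = (s i : ℂ) • fun t : Fin r → ℂˣ => (t i : ℂ) := by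
      ext t
      exact Units.val_mul _ _
    change P (fun t => (t i : ℂ)) ∈ torusRing r
    rw [h1]
    exact Subalgebra.smul_mem _ (coord_mem_torusRing i) _
  · have h1 : P (fun t => (t i : ℂ)⁻¹) = (s i : ℂ)⁻¹ • fun t : Fin r → ℂˣ => (t i : ℂ)⁻¹ := by
      ext t
      change ((s i * t i : ℂˣ) : ℂ)⁻¹ = (s i : ℂ)⁻¹ * (t i : ℂ)⁻¹
      rw [Units.val_mul, mul_inv]
    change P (fun t => (t i : ℂ)⁻¹) ∈ torusRing r
    rw [h1]
    exact Subalgebra.smul_mem _ (inv_coord_mem_torusRing i) _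

/-- The comorphism of `[ρ] ↦ [ζ ρ]`. -/
noncomputable def scaleSLComorphism (ζ : Fin r → rootsOfUnity n ℂ) : SLRing n r →ₐ[ℂ] SLRing n r :=
  ((AlgHom.pi fun ρ => Pi.evalAlgHom ℂ (fun _ => ℂ) (scaleSL ζ ρ)).comp
    (SLRing n r).val).codRestrict _ (comp_scaleSL_mem ζ)

/-- The comorphism of the translation `t ↦ s t`. -/
noncomputable def translationComorphism (s : Fin r → ℂˣ) : torusRing r →ₐ[ℂ] torusRing r :=
  ((AlgHom.pi fun t : Fin r → ℂˣ => Pi.evalAlgHom ℂ (fun _ => ℂ) (fun i => s i * t i)).comp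
    (torusRing r).val).codRestrict _ (comp_mul_mem_torusRing s)

/-- The comorphism of `([ρ], t) ↦ ([ζ ρ], ζ⁻¹ t)`. -/
noncomputable def actionComorphism (ζ : Fin r → rootsOfUnity n ℂ) :
    ProdRing n r →ₐ[ℂ] ProdRing n r :=
  Algebra.TensorProduct.map (scaleSLComorphism ζ)
    (translationComorphism fun i => (ζ i : ℂˣ)⁻¹)

theorem prodPoint_actionComorphism (ζ : Fin r → rootsOfUnity n ℂ)
    (ρ : Rep r (Matrix.SpecialLinearGroup (Fin n) ℂ)) (t : Fin r → ℂˣ) :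
    (prodPoint ρ t).comp (actionComorphism ζ) =
      prodPoint (scaleSL ζ ρ) (fun i => (ζ i : ℂˣ)⁻¹ * t i) :=
  Algebra.TensorProduct.ext' fun f w => by
    rw [AlgHom.comp_apply, actionComorphism, Algebra.TensorProduct.map_tmul, prodPoint, prodPoint,
      Algebra.TensorProduct.productMap_apply_tmul, Algebra.TensorProduct.productMap_apply_tmul]
    rfl

/-- The action of `μ_n ^ r` on the coordinate ring of `X_r(SL_n) × (ℂ*)^r`. -/
noncomputable def rootsAction (n r : ℕ) :
    (Fin r → rootsOfUnity n ℂ) →* (ProdRing n r ≃ₐ[ℂ] ProdRing n r) :=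
  (AlgEquiv.algHomUnitsEquiv ℂ (ProdRing n r)).toMonoidHom.comp
    -- A monoid homomorphism from a group lands in the units, here the automorphisms. Pull-back
    -- reverses products, harmlessly as `μ_n^r` is commutative.
    (MonoidHom.toHomUnits
      { toFun := fun ζ => (actionComorphism ζ : ProdRing n r →ₐ[ℂ] ProdRing n r)
        map_one' := AlgHom.ext fun b => prodRing_ext fun ρ t => by
          rw [← AlgHom.comp_apply, prodPoint_actionComorphism, scaleSL_one]
          simp
        map_mul' := fun ζ η => AlgHom.ext fun b => prodRing_ext fun ρ t => by
          rw [← AlgHom.comp_apply, prodPoint_actionComorphism, AlgHom.mul_apply,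
            ← AlgHom.comp_apply (prodPoint ρ t), prodPoint_actionComorphism, ← AlgHom.comp_apply,
            prodPoint_actionComorphism, scaleSL_scaleSL]
          congr 3
          ext i
          simp [mul_comm, mul_assoc] })

theorem prodPoint_rootsAction (ζ : Fin r → rootsOfUnity n ℂ)
    (ρ : Rep r (Matrix.SpecialLinearGroup (Fin n) ℂ)) (t : Fin r → ℂˣ) (b : ProdRing n r) :
    prodPoint ρ t (rootsAction n r ζ b) =
      prodPoint (scaleSL ζ ρ) (fun i => (ζ i : ℂˣ)⁻¹ * t i) b := by
  rw [← prodPoint_actionComorphism]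
  rfl

/-- The coordinate `t_i` on `X_r(SL_n) × (ℂ*)^r`. -/
noncomputable def torusCoord (n : ℕ) {r : ℕ} (i : Fin r) : ProdRing n r :=
  1 ⊗ₜ ⟨_, coord_mem_torusRing i⟩

theorem prodPoint_torusCoord (ρ : Rep r (Matrix.SpecialLinearGroup (Fin n) ℂ)) (t : Fin r → ℂˣ)
    (i : Fin r) : prodPoint ρ t (torusCoord n i) = t i := by
  rw [prodPoint, torusCoord, Algebra.TensorProduct.productMap_apply_tmul, map_one, one_mul]
  rfl

theorem isUnit_torusCoord (i : Fin r) : IsUnit (torusCoord n i) := by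
  refine IsUnit.of_mul_eq_one (1 ⊗ₜ ⟨_, inv_coord_mem_torusRing i⟩) ?_
  rw [torusCoord, Algebra.TensorProduct.tmul_mul_tmul, one_mul, Algebra.TensorProduct.one_def]
  congr 1
  ext t
  exact mul_inv_cancel₀ (Units.ne_zero (t i))

theorem rootsAction_torusCoord (ζ : Fin r → rootsOfUnity n ℂ) (i : Fin r) :
    rootsAction n r ζ (torusCoord n i) = ((ζ i : ℂˣ) : ℂ)⁻¹ • torusCoord n i :=
  prodRing_ext fun ρ t => by
    rw [prodPoint_rootsAction, prodPoint_torusCoord, map_smul, prodPoint_torusCoord,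
      Units.val_mul, Units.val_inv_eq_inv_val, smul_eq_mul]

/-- The coordinate `t_i` is nonzero at every point and is multiplied by `ζ_i⁻¹`. -/
theorem rootsAction_free (ζ : Fin r → rootsOfUnity n ℂ) (p : ProdRing n r →ₐ[ℂ] ℂ)
    (h : p.comp (rootsAction n r ζ).toAlgHom = p) : ζ = 1 := by
  funext i
  have h1 : p (rootsAction n r ζ (torusCoord n i)) = p (torusCoord n i) :=
    DFunLike.congr_fun h (torusCoord n i)
  rw [rootsAction_torusCoord, map_smul, smul_eq_mul] at h1
  have h2 := mul_eq_right₀ ((isUnit_torusCoord (n := n) i).map p).ne_zero |>.1 h1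
  exact Subtype.ext (Units.ext (inv_eq_one.1 h2))

end Action

/-! ### Invariants of `μ_n^r` by averaging. -/

section Invariants

variable {n r : ℕ}

/-- The functions `g(t ρ) w(t)`. -/
noncomputable def twistedEval (n r : ℕ) : GLRepRing n r ⊗[ℂ] torusRing r →ₐ[ℂ]
    (Rep r (Matrix.SpecialLinearGroup (Fin n) ℂ) × (Fin r → ℂˣ) → ℂ) :=
  Algebra.TensorProduct.productMap ((scalePullback n r).comp (GLRepRing n r).val)
    ((AlgHom.pi fun p => Pi.evalAlgHom ℂ (fun _ => ℂ) p.2).comp (torusRing r).val)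

theorem twistedEval_tmul (g : GLRepRing n r) (w : torusRing r)
    (ρ : Rep r (Matrix.SpecialLinearGroup (Fin n) ℂ)) (t : Fin r → ℂˣ) :
    twistedEval n r (g ⊗ₜ w) (ρ, t) =
      (g : Rep r (GL (Fin n) ℂ) → ℂ) (scaleGL ρ t) * (w : (Fin r → ℂˣ) → ℂ) t := rfl

/-- Entries of `ρ(x_i)` are those of `t ρ(x_i)` times `t_i⁻¹`. Since the action fixes `t ρ`, only
the torus factor then needs averaging. -/
theorem fst_mem_range_twistedEval {f : Rep r (Matrix.SpecialLinearGroup (Fin n) ℂ) → ℂ}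
    (hf : f ∈ SLRepRing n r) : (fun p => f p.1) ∈ (twistedEval n r).range := by
  let P : (Rep r (Matrix.SpecialLinearGroup (Fin n) ℂ) → ℂ) →ₐ[ℂ]
      (Rep r (Matrix.SpecialLinearGroup (Fin n) ℂ) × (Fin r → ℂˣ) → ℂ) :=
    AlgHom.pi fun p => Pi.evalAlgHom ℂ (fun _ => ℂ) p.1
  suffices h : SLRepRing n r ≤ (twistedEval n r).range.comap P from h hf
  refine SLRepRing_induction _ fun i j k => ?_
  refine ⟨⟨_, entry_mem_GLRepRing i j k⟩ ⊗ₜ ⟨_, inv_coord_mem_torusRing i⟩, ?_⟩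
  ext ⟨ρ, t⟩
  change (scaleGL ρ t (FreeGroup.of i) : Matrix (Fin n) (Fin n) ℂ) j k * (t i : ℂ)⁻¹ =
    (ρ (FreeGroup.of i) : Matrix (Fin n) (Fin n) ℂ) j k
  rw [coe_scaleGL_of, Matrix.smul_apply, smul_eq_mul, mul_right_comm,
    mul_inv_cancel₀ (Units.ne_zero (t i)), one_mul]

theorem prodEval_mem_range_twistedEval (b : ProdRing n r) :
    prodEval n r b ∈ (twistedEval n r).range := by
  induction b using TensorProduct.induction_on with
  | zero => rw [map_zero]; exact zero_mem _
  | tmul f w =>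
    have h : prodEval n r (f ⊗ₜ w) = (fun p => (f : _ → ℂ) p.1) * twistedEval n r (1 ⊗ₜ w) := by
      ext ⟨ρ, t⟩
      rw [Pi.mul_apply, twistedEval_tmul]
      change _ = (f : _ → ℂ) ρ * (1 * _)
      rw [one_mul]
      rfl
    rw [h]
    exact mul_mem (fst_mem_range_twistedEval f.2.1) ⟨_, rfl⟩
  | add b c hb hc => rw [map_add]; exact add_mem hb hc

theorem sum_torusMonomial_translates [NeZero n] (d : Multiplicative (Fin r → ℤ))
    (t : Fin r → ℂˣ) :
    ∑ ζ : Fin r → rootsOfUnity n ℂ, torusMonomial r d (fun i => (ζ i : ℂˣ)⁻¹ * t i) =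
      (∑ ζ, rootChar n (fun i => -(Multiplicative.toAdd d i)) ζ) * torusMonomial r d t := by
  rw [Finset.sum_mul]
  refine Finset.sum_congr rfl fun ζ _ => ?_
  rw [rootChar_apply, torusMonomial_apply, torusMonomial_apply, ← Finset.prod_mul_distrib]
  refine Finset.prod_congr rfl fun i _ => ?_
  rw [Units.val_mul, Units.val_inv_eq_inv_val, mul_zpow, inv_zpow', zpow_neg]

theorem exists_sum_torusMonomial_translates [NeZero n] (d : Multiplicative (Fin r → ℤ)) :
    ∃ h ∈ GLRepRing n r, ∀ (ρ : Rep r (Matrix.SpecialLinearGroup (Fin n) ℂ)) (t : Fin r → ℂˣ),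
      ∑ ζ : Fin r → rootsOfUnity n ℂ, torusMonomial r d (fun i => (ζ i : ℂˣ)⁻¹ * t i) =
        h (scaleGL ρ t) := by
  simp_rw [sum_torusMonomial_translates]
  by_cases hd : ∀ i, (n : ℤ) ∣ -(Multiplicative.toAdd d i)
  -- With `n k_i = -d_i`, `det(t ρ(x_i))^(-k_i) = t_i^(d_i)`; the value `c` of the character sum
  -- plays no role.
  · choose k hk using hd
    have hmem : (∏ i, fun σ : Rep r (GL (Fin n) ℂ) =>
        (σ (FreeGroup.of i) : Matrix (Fin n) (Fin n) ℂ).det ^ (-k i)) ∈ GLRepRing n r :=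
      prod_mem fun i _ => zpow_det_mem_GLRepRing i _
    generalize ∑ ζ : Fin r → rootsOfUnity n ℂ,
      rootChar n (fun i => -(Multiplicative.toAdd d i)) ζ = c
    refine ⟨_, Subalgebra.smul_mem _ hmem c, fun ρ t => ?_⟩
    rw [Pi.smul_apply, smul_eq_mul, Finset.prod_apply, torusMonomial_apply]
    congr 1
    refine Finset.prod_congr rfl fun i _ => ?_
    rw [det_scaleGL_of, ← zpow_natCast, ← zpow_mul, mul_neg, ← hk, neg_neg]
  · refine ⟨0, zero_mem _, fun ρ t => ?_⟩
    rw [sum_rootChar _ hd, zero_mul]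
    rfl

/-- The sum of the translates by roots of unity of a function on the torus is a function of the
determinants. -/
theorem sum_torus_translates [NeZero n] (w : torusRing r) :
    ∃ h ∈ GLRepRing n r, ∀ (ρ : Rep r (Matrix.SpecialLinearGroup (Fin n) ℂ)) (t : Fin r → ℂˣ),
      ∑ ζ : Fin r → rootsOfUnity n ℂ, (w : (Fin r → ℂˣ) → ℂ) (fun i => (ζ i : ℂˣ)⁻¹ * t i) =
        h (scaleGL ρ t) := by
  have hw := torusRing_le_span_monomials w.2
  generalize (w : (Fin r → ℂˣ) → ℂ) = w at hw
  induction hw using Submodule.span_induction with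
  | mem w hw =>
    obtain ⟨d, rfl⟩ := hw
    exact exists_sum_torusMonomial_translates d
  | zero => exact ⟨0, zero_mem _, fun ρ t => Finset.sum_const_zero⟩
  | add v w _ _ hv hw =>
    obtain ⟨f, hf, hf'⟩ := hv
    obtain ⟨g, hg, hg'⟩ := hw
    refine ⟨f + g, add_mem hf hg, fun ρ t => ?_⟩
    rw [Pi.add_apply, ← hf', ← hg', ← Finset.sum_add_distrib]
    rfl
  | smul c w _ hw =>
    obtain ⟨f, hf, hf'⟩ := hw
    refine ⟨c • f, Subalgebra.smul_mem _ hf _, fun ρ t => ?_⟩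
    rw [Pi.smul_apply, ← hf', Finset.smul_sum]
    rfl

/-- In a term `g(t ρ) w(t)` the first factor is constant on orbits. Conjugation invariance of `h` is
not claimed, as `g` need not be invariant. -/
theorem sum_translates [NeZero n] (b : ProdRing n r) :
    ∃ h ∈ GLRepRing n r, ∀ (ρ : Rep r (Matrix.SpecialLinearGroup (Fin n) ℂ)) (t : Fin r → ℂˣ),
      ∑ ζ, prodPoint ρ t (rootsAction n r ζ b) = h (scaleGL ρ t) := by
  simp_rw [prodPoint_rootsAction, prodPoint_apply]
  obtain ⟨z, hz⟩ : ∃ z, twistedEval n r z = prodEval n r b := prodEval_mem_range_twistedEval b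
  rw [← hz]
  clear hz
  induction z using TensorProduct.induction_on with
  | zero => exact ⟨0, zero_mem _, fun ρ t => by simp⟩
  | tmul g w =>
    obtain ⟨h, hh, hh'⟩ := sum_torus_translates (n := n) w
    refine ⟨g * h, mul_mem g.2 hh, fun ρ t => ?_⟩
    simp_rw [twistedEval_tmul, scaleGL_scaleSL]
    rw [← Finset.mul_sum, hh' ρ t]
    rfl
  | add v w hv hw =>
    obtain ⟨f, hf, hf'⟩ := hv
    obtain ⟨g, hg, hg'⟩ := hw
    refine ⟨f + g, add_mem hf hg, fun ρ t => ?_⟩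
    rw [Pi.add_apply, ← hf', ← hg', ← Finset.sum_add_distrib, map_add]
    rfl

theorem prodPoint_conj (g : Matrix.SpecialLinearGroup (Fin n) ℂ)
    (ρ : Rep r (Matrix.SpecialLinearGroup (Fin n) ℂ)) (t : Fin r → ℂˣ) :
    prodPoint (conj g ρ) t = prodPoint ρ t := by
  have h : charPoint (Matrix.SpecialLinearGroup.toGL (n := Fin n) (R := ℂ)) (conj g ρ) =
      charPoint (Matrix.SpecialLinearGroup.toGL (n := Fin n) (R := ℂ)) ρ :=
    AlgHom.ext fun f => f.2.2 g ρ
  rw [prodPoint, prodPoint, h]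

theorem mem_range_scaleComorphism_iff [NeZero n] (b : ProdRing n r) :
    b ∈ (scaleComorphism n r).range ↔ ∀ ζ, rootsAction n r ζ b = b := by
  constructor
  · rintro ⟨f, rfl⟩ ζ
    refine prodRing_ext fun ρ t => ?_
    change prodPoint ρ t (rootsAction n r ζ (scaleComorphism n r f)) =
      prodPoint ρ t (scaleComorphism n r f)
    rw [prodPoint_rootsAction, prodPoint_scaleComorphism, prodPoint_scaleComorphism,
      scaleGL_scaleSL]
  · intro hb
    obtain ⟨h, hh, hsum⟩ := sum_translates b
    let N : ℂ := (Fintype.card (Fin r → rootsOfUnity n ℂ) : ℂ)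
    have hN : N ≠ 0 := Nat.cast_ne_zero.2 Fintype.card_ne_zero
    have hval (ρ : Rep r (Matrix.SpecialLinearGroup (Fin n) ℂ)) (t : Fin r → ℂˣ) :
        (N⁻¹ • h) (scaleGL ρ t) = prodPoint ρ t b := by
      rw [Pi.smul_apply, ← hsum]
      simp_rw [hb]
      rw [Finset.sum_const, Finset.card_univ, nsmul_eq_mul, smul_eq_mul, inv_mul_cancel_left₀ hN]
    refine ⟨⟨N⁻¹ • h, Subalgebra.smul_mem _ hh _, fun g σ => ?_⟩, prodRing_ext fun ρ t => ?_⟩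
    -- Invariance is recovered from the values: at `t ρ` the function is the value of `b` at `([ρ],
    -- t)`, which depends only on the class of `ρ`.
    · obtain ⟨s, a, rfl⟩ := exists_eq_smul_toGL (NeZero.ne n) g
      obtain ⟨ρ, t, rfl⟩ := exists_eq_scaleGL (NeZero.ne n) σ
      rw [conj_smul_toGL, hval, hval, prodPoint_conj]
    · exact (prodPoint_scaleComorphism ρ t _).trans (hval ρ t)

end Invariants

end CharVar

/-! ### The main theorem. -/

theorem mainTheorem11 (n r : ℕ) (hn : 1 ≤ n) :
    ∃ (φ : CharVar.GLRing n r →ₐ[ℂ] CharVar.ProdRing n r)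
      (α : (Fin r → rootsOfUnity n ℂ) →* (CharVar.ProdRing n r ≃ₐ[ℂ] CharVar.ProdRing n r))
      (Φ : CharVar.XSLTorus n r ⟶ CharVar.XGL n r),
      Φ = AlgebraicGeometry.Spec.map (CommRingCat.ofHom φ.toRingHom) ∧
      -- the morphism `Φ` is `([ρ], t) ↦ [t ρ]`
      (∀ (ρ : CharVar.Rep r (Matrix.SpecialLinearGroup (Fin n) ℂ)) (t : Fin r → ℂˣ),
        (CharVar.prodPoint ρ t).comp φ =
          CharVar.charPoint (MonoidHom.id (GL (Fin n) ℂ)) (CharVar.scaleGL ρ t)) ∧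
      -- the action is `ζ · ([ρ], t) = ([ζ ρ], ζ⁻¹ t)`
      (∀ (ζ : Fin r → rootsOfUnity n ℂ)
          (ρ : CharVar.Rep r (Matrix.SpecialLinearGroup (Fin n) ℂ)) (t : Fin r → ℂˣ),
        (CharVar.prodPoint ρ t).comp
            (α ζ).toAlgHom =
          CharVar.prodPoint (CharVar.scaleSL ζ ρ) (fun i => ((ζ i : ℂˣ))⁻¹ * t i)) ∧
      -- `Φ` is the quotient by this free action, and it is étale and surjective
      CharVar.IsFreeQuotient (A := CharVar.GLRing n r) (B := CharVar.ProdRing n r) α φ ∧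
      AlgebraicGeometry.Etale Φ ∧
      AlgebraicGeometry.Surjective Φ := by
  have : NeZero n := ⟨by omega⟩
  have hinj := CharVar.scaleComorphism_injective (r := r) (NeZero.ne n)
  have hinv := CharVar.mem_range_scaleComorphism_iff (n := n) (r := r)
  refine ⟨CharVar.scaleComorphism n r, CharVar.rootsAction n r, _, rfl, fun ρ t => ?_,
    fun ζ ρ t => CharVar.prodPoint_actionComorphism ζ ρ t,
    CharVar.isFreeQuotient_of_invariants CharVar.rootsAction_free hinj hinv, ?_, ?_⟩
  · exact AlgHom.ext fun f => CharVar.prodPoint_scaleComorphism ρ t f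
  · rw [AlgebraicGeometry.HasRingHomProperty.Spec_iff (P := @AlgebraicGeometry.Etale)]
    exact CharVar.etale_of_rootsOfUnity_action CharVar.isUnit_torusCoord
      CharVar.rootsAction_torusCoord hinj hinv
  · exact CharVar.surjective_specMap_of_invariants hinj hinv
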